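/- **Definitions.** For a finite group $G$, let $\pi(G)$ be the set of primes dividing $|G|$. The prime graph of $G$ is the graph with vertex set $\pi(G)$ in which distinct vertices $r,s$ are joined by an edge if and only if $G$ has an element of order $rs$; its complement (on the same vertex set $\pi(G)$) is denoted $\overline{\Gamma}(G)$. These graphs are labelled by primes, and an equality between them means equality of vertex sets and of edge sets. For a simple group $T$, a group $G$ is *strictly $T$-solvable* if every composition factor of $G$ is cyclic or isomorphic to $T$, and at least one composition factor of $G$ is isomorphic to $T$. Let $p$ be a prime, let $\mathbb{F}=\overline{\mathbb{F}}_p$ be an algebraic closure of the field with $p$ elements, and fix an injective homomorphism $\lambda\colon\mathbb{F}^\times\to\mathbb{C}^\times$. The Brauer character mod $p$ of a representation $\varphi\colon T\to\mathrm{GL}_n(\mathbb{F})$ of a finite group $T$ is the complex-valued function on the set of elements $g\in T$ of order not divisible by $p$ given by $g\mapsto\sum_{i=1}^n\lambda(\varepsilon_i)$, where $\varepsilon_1,\dots,\varepsilon_n$ are the eigenvalues of $\varphi(g)$ with multiplicity. It is called irreducible if $\varphi$ is irreducible. **Theorem.** Let $T$ be a finite simple group, let $p\in\pi(T)$, and let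 $\chi$ be an irreducible Brauer character of $T$ mod $p$. Let $R\subseteq\pi(T)\setminus\{p\}$ be the set of primes $r\neq p$ for which there exists an element $t\in T$ of order $r$ such that $$\frac{1}{o(t)}\sum_{x\in\langle t\rangle}\chi(x)>0 ,$$ where $o(t)$ denotes the order of $t$. Then there exists a finite strictly $T$-solvable group $G$ such that $$\overline{\Gamma}(G)=\overline{\Gamma}(T)\setminus\{\,p-r \mid r\in R\,\},$$ that is, $\overline{\Gamma}(G)$ is the graph obtained from $\overline{\Gamma}(T)$ by deleting all edges joining $p$ to a prime in $R$, keeping all vertices. -/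

import Mathlib

universe u v w

/-! ### Prime graphs

A labelled graph whose vertices are natural numbers is a subgraph of the complete graph on `ℕ`;
it carries its own vertex set, so that equality of labelled graphs means equality of the vertex
sets and of the edge sets. -/

/-- Graphs whose vertices are labelled by natural numbers. -/
abbrev LabelledGraph : Type := (⊤ : SimpleGraph ℕ).Subgraph

/-- The set `π(G)` of primes that divide the order of `G`. -/
def primeDivisors (G : Type u) : Set ℕ := {r | r.Prime ∧ r ∣ Nat.card G}

/-- The prime graph (Gruenberg-Kegel graph) of `G`: the vertices are the prime divisors of the
order of `G`, and distinct vertices `r`, `s` are joined when `G` has an element of order `r * s`. -/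
def primeGraph (G : Type u) [Group G] : LabelledGraph where
  verts := primeDivisors G
  Adj r s := r ∈ primeDivisors G ∧ s ∈ primeDivisors G ∧ r ≠ s ∧ ∃ g : G, orderOf g = r * s
  adj_sub h := h.2.2.1
  edge_vert h := h.1
  symm := ⟨fun _ _ ⟨hr, hs, hne, g, hg⟩ =>
    ⟨hs, hr, hne.symm, g, hg.trans (Nat.mul_comm _ _)⟩⟩

/-- The complement of a labelled graph, on the same vertex set. -/
def LabelledGraph.complement (Γ : LabelledGraph) : LabelledGraph where
  verts := Γ.verts
  Adj r s := r ∈ Γ.verts ∧ s ∈ Γ.verts ∧ r ≠ s ∧ ¬ Γ.Adj r s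
  adj_sub h := h.2.2.1
  edge_vert h := h.1
  symm := ⟨fun _ _ ⟨hr, hs, hne, h⟩ => ⟨hs, hr, hne.symm, fun h2 => h h2.symm⟩⟩

/-- The complement of the prime graph of `G`. -/
def primeGraphCompl (G : Type u) [Group G] : LabelledGraph :=
  LabelledGraph.complement (primeGraph G)

/-! ### Composition series and `T`-solvable groups -/

/-- A composition series `1 = H₀ ⊲ H₁ ⊲ ⋯ ⊲ Hₙ = G`: each term is normal in the next one, with
simple quotient. -/
structure GroupCompositionSeries (G : Type u) [Group G] where
  length : ℕ
  term : Fin (length + 1) → Subgroup G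
  term_zero : term 0 = ⊥
  term_last : term (Fin.last length) = ⊤
  le_succ : ∀ i : Fin length, term i.castSucc ≤ term i.succ
  normal : ∀ i : Fin length, ((term i.castSucc).subgroupOf (term i.succ)).Normal
  simple : ∀ i : Fin length,
    IsSimpleGroup (term i.succ ⧸ (term i.castSucc).subgroupOf (term i.succ))

/-- The `i`-th factor `Hᵢ₊₁ / Hᵢ` of a composition series. -/
abbrev GroupCompositionSeries.factor {G : Type u} [Group G] (c : GroupCompositionSeries G)
    (i : Fin c.length) : Type u :=
  c.term i.succ ⧸ (c.term i.castSucc).subgroupOf (c.term i.succ)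

instance GroupCompositionSeries.factorGroup {G : Type u} [Group G] (c : GroupCompositionSeries G)
    (i : Fin c.length) : Group (c.factor i) :=
  haveI := c.normal i
  QuotientGroup.Quotient.group _

/-- `S` is a composition factor of `G`. -/
def IsCompositionFactor (S : Type v) [Group S] (G : Type u) [Group G] : Prop :=
  ∃ (c : GroupCompositionSeries G) (i : Fin c.length), Nonempty (c.factor i ≃* S)

/-- `G` is `T`-solvable: every composition factor of `G` is cyclic or isomorphic to `T`. -/
def IsSolvableRel (T : Type v) [Group T] (G : Type u) [Group G] : Prop :=
  ∀ (c : GroupCompositionSeries G) (i : Fin c.length),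
    IsCyclic (c.factor i) ∨ Nonempty (c.factor i ≃* T)

/-- `G` is strictly `T`-solvable: it is `T`-solvable and `T` is one of its composition factors. -/
def IsStrictlySolvableRel (T : Type v) [Group T] (G : Type u) [Group G] : Prop :=
  IsSolvableRel T G ∧ IsCompositionFactor T G

/-! ### Brauer characters -/

/-- The `p`-regular elements of `T`: those of order not divisible by `p`. -/
abbrev PRegular (p : ℕ) (T : Type u) [Group T] : Type u := {g : T // ¬ p ∣ orderOf g}

/-- Every element of the cyclic group generated by a `p`-regular element is `p`-regular. -/
theorem PRegular.not_dvd_of_mem_zpowers {p : ℕ} {T : Type u} [Group T] (t : PRegular p T)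
    (x : Subgroup.zpowers t.1) : ¬ p ∣ orderOf x.1 :=
  fun h => t.2 (h.trans (orderOf_dvd_of_mem_zpowers x.2))

/-- The Brauer character of a representation `ρ` over the algebraic closure of `𝔽_p`: a `p`-regular
element `g` is sent to the sum of the lifts to `ℂ` of the eigenvalues of `ρ g`, counted with
multiplicity. An injective homomorphism `lift` of monoids with zero is the same thing as an
embedding of the multiplicative group of the field into that of `ℂ`, that is, an isomorphism of
that group with the group of complex roots of unity of order prime to `p`. -/
noncomputable def brauerCharacter {p : ℕ} [Fact p.Prime]
    (lift : AlgebraicClosure (ZMod p) →*₀ ℂ) {T : Type u} [Group T]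
    {V : Type w} [AddCommGroup V] [Module (AlgebraicClosure (ZMod p)) V]
    [FiniteDimensional (AlgebraicClosure (ZMod p)) V]
    (ρ : Representation (AlgebraicClosure (ZMod p)) T V) (g : PRegular p T) : ℂ :=
  ((ρ g.1).charpoly.roots.map lift).sum

/-- `χ` is an irreducible Brauer character of `T` mod `p` (with respect to `lift`). -/
def IsIrreducibleBrauerCharacter {p : ℕ} [Fact p.Prime]
    (lift : AlgebraicClosure (ZMod p) →*₀ ℂ) {T : Type u} [Group T] (χ : PRegular p T → ℂ) : Prop :=
  ∃ (n : ℕ) (ρ : Representation (AlgebraicClosure (ZMod p)) T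
      (Fin n → AlgebraicClosure (ZMod p))),
    ρ.IsIrreducible ∧ χ = brauerCharacter lift ρ

/-- The average of `χ` over the cyclic group generated by the `p`-regular element `t`. -/
noncomputable def cyclicAverage {p : ℕ} {T : Type u} [Group T] (χ : PRegular p T → ℂ)
    (t : PRegular p T) : ℂ :=
  1 / (orderOf t.1 : ℂ) *
    ∑ᶠ x : Subgroup.zpowers t.1, χ ⟨x.1, PRegular.not_dvd_of_mem_zpowers t x⟩

open scoped ComplexOrder in
/-- The set of primes `r` such that the average of `χ` over the cyclic group generated by some
(`p`-regular) element of order `r` is positive, i.e. a positive real number. -/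
def positiveAveragePrimes {p : ℕ} {T : Type u} [Group T] (χ : PRegular p T → ℂ) : Set ℕ :=
  {r | r.Prime ∧ ∃ t : PRegular p T, orderOf t.1 = r ∧ 0 < cyclicAverage χ t}

/-!
Let `ρ` afford `χ`. The lift of an eigenvalue `ε` of `ρ t` is a root of unity of order dividing
`o(t)`, so its powers sum to zero over a period unless `ε = 1`. The average of `χ` over `⟨t⟩` is
therefore the multiplicity of the eigenvalue `1` of `ρ t`, and it is positive exactly when `ρ t`
fixes a nonzero vector.

The representation space has exponent `p`, and as `T` is finite it contains a finite `T`-invariant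
additive subgroup `W` meeting the fixed space of every `t` that has a nonzero fixed vector. Let
`G = W ⋊ T`. Its composition factors are those of `W` together with `T`, and orders prime to `p`
are the same in `G` as in `T`. If `g` has order `p * r` and its image `t` does not, then `t` has
order `r` and `g ^ r` is a nonzero element of `W`, fixed by `t` because it commutes with `g` and
`W` is abelian. Conversely such a fixed vector times `t` has order `p * r`.
-/

section Eigenvalues

open Polynomial Module

variable {K : Type*} [Field K] {V : Type*} [AddCommGroup V] [Module K V] [FiniteDimensional K V]

theorem mem_roots_charpoly_iff_hasEigenvalue {A : End K V} {ε : K} :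
    ε ∈ A.charpoly.roots ↔ A.HasEigenvalue ε := by
  rw [mem_roots A.charpoly_monic.ne_zero, End.hasEigenvalue_iff_isRoot_charpoly]

theorem pow_eq_one_of_mem_roots_charpoly {A : End K V} {m : ℕ} (hA : A ^ m = 1) {ε : K}
    (hε : ε ∈ A.charpoly.roots) : ε ^ m = 1 := by
  obtain ⟨v, hv⟩ := (mem_roots_charpoly_iff_hasEigenvalue.1 hε).exists_hasEigenvector
  refine smul_left_injective K hv.2 ?_
  simp only [← hv.pow_apply, hA, End.one_apply, one_smul]

theorem one_mem_roots_charpoly_iff {A : End K V} :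
    1 ∈ A.charpoly.roots ↔ ∃ v, v ≠ 0 ∧ A v = v := by
  rw [mem_roots_charpoly_iff_hasEigenvalue, End.HasEigenvalue, End.HasUnifEigenvalue,
    Submodule.ne_bot_iff]
  simp only [End.mem_eigenspace_iff, one_smul, and_comm]

variable [IsAlgClosed K]

theorem card_roots_charpoly (A : End K V) : A.charpoly.roots.card = finrank K V := by
  rw [← (IsAlgClosed.splits A.charpoly).natDegree_eq_card_roots, LinearMap.charpoly_natDegree]

theorem det_sub_algebraMap_eq_prod_roots_charpoly (A : End K V) (b : K) :
    LinearMap.det (A - algebraMap K (End K V) b) =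
      (A.charpoly.roots.map fun ε => ε - b).prod := by
  rw [← neg_sub, ← neg_one_smul K, LinearMap.det_smul, ← LinearMap.eval_charpoly,
    (IsAlgClosed.splits _).eval_eq_prod_roots_of_monic A.charpoly_monic, ← card_roots_charpoly A,
    ← Multiset.card_map (fun ε => b - ε), ← Multiset.prod_map_neg, Multiset.map_map]
  simp only [Function.comp_apply, neg_sub]

theorem det_aeval_eq_prod_roots_charpoly (A : End K V) (f : K[X]) :
    LinearMap.det (aeval A f) = (A.charpoly.roots.map fun ε => f.eval ε).prod := by
  have det_aeval_multiset_prod (s : Multiset K[X]) :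
      LinearMap.det (aeval A s.prod) = (s.map fun g => LinearMap.det (aeval A g)).prod :=
    map_multiset_prod (LinearMap.det.comp (MonoidHomClass.toMonoidHom (aeval A))) s
  calc LinearMap.det (aeval A f)
      = f.leadingCoeff ^ A.charpoly.roots.card *
          (f.roots.map fun b => (A.charpoly.roots.map fun ε => ε - b).prod).prod := by
        conv_lhs => rw [(IsAlgClosed.splits f).eq_prod_roots, ← smul_eq_C_mul]
        rw [map_smul, LinearMap.det_smul, card_roots_charpoly, det_aeval_multiset_prod,
          Multiset.map_map]
        simp only [Function.comp_apply, map_sub, aeval_X, aeval_C,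
          det_sub_algebraMap_eq_prod_roots_charpoly]
    _ = (A.charpoly.roots.map fun ε =>
          f.leadingCoeff * (f.roots.map fun b => ε - b).prod).prod := by
        rw [Multiset.prod_map_mul, Multiset.map_const', Multiset.prod_replicate,
          Multiset.prod_map_prod_map]
    _ = (A.charpoly.roots.map fun ε => f.eval ε).prod := by
        simp only [← (IsAlgClosed.splits f).eval_eq_prod_roots]

theorem roots_charpoly_pow (A : End K V) (k : ℕ) :
    (A ^ k).charpoly.roots = A.charpoly.roots.map (· ^ k) := by
  suffices (A ^ k).charpoly = ((A.charpoly.roots.map (· ^ k)).map fun a => X - C a).prod by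
    rw [this, roots_multiset_prod_X_sub_C]
  refine Polynomial.funext fun x => ?_
  calc (A ^ k).charpoly.eval x
      = LinearMap.det (aeval A (C x - X ^ k)) := by simp [LinearMap.eval_charpoly]
    _ = (A.charpoly.roots.map fun ε => x - ε ^ k).prod := by
        simp only [det_aeval_eq_prod_roots_charpoly, eval_sub, eval_C, eval_pow, eval_X]
    _ = _ := by
        simp only [eval_multiset_prod, Multiset.map_map, Function.comp_apply, eval_sub, eval_X,
          eval_C]

end Eigenvalues

section RootsOfUnity

variable {R : Type*} [CommRing R] [IsDomain R] [DecidableEq R] {m : ℕ}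

theorem sum_range_pow_eq_ite {z : R} (hz : z ^ m = 1) :
    ∑ i ∈ Finset.range m, z ^ i = if z = 1 then (m : R) else 0 := by
  split_ifs with h
  · simp [h]
  · refine (mul_eq_zero.1 ?_).resolve_right (sub_ne_zero.2 h)
    rw [geom_sum_mul, hz, sub_self]

theorem sum_range_sum_map_pow_eq_mul_count {s : Multiset R} (hs : ∀ z ∈ s, z ^ m = 1) :
    ∑ i ∈ Finset.range m, (s.map (· ^ i)).sum = m * s.count 1 := by
  rw [← Multiset.sum_map_sum, Multiset.map_congr rfl fun z hz => sum_range_pow_eq_ite (hs z hz),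
    Finset.sum_multiset_map_count]
  simp +contextual [mul_comm, Multiset.count_eq_zero_of_notMem]

end RootsOfUnity

section BrauerCharacter

variable {p : ℕ} [Fact p.Prime] {lift : AlgebraicClosure (ZMod p) →*₀ ℂ}
  (hlift : Function.Injective lift) {T : Type u} [Group T]
  {V : Type w} [AddCommGroup V] [Module (AlgebraicClosure (ZMod p)) V]
  [FiniteDimensional (AlgebraicClosure (ZMod p)) V]
  (ρ : Representation (AlgebraicClosure (ZMod p)) T V)

theorem finsum_zpowers_brauerCharacter (lift : AlgebraicClosure (ZMod p) →*₀ ℂ)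
    (t : PRegular p T) (ht : IsOfFinOrder t.1) :
    ∑ᶠ x : Subgroup.zpowers t.1,
        brauerCharacter lift ρ ⟨x.1, PRegular.not_dvd_of_mem_zpowers t x⟩ =
      ∑ i ∈ Finset.range (orderOf t.1), (((ρ t.1).charpoly.roots.map lift).map (· ^ i)).sum := by
  rw [← finsum_comp_equiv (finEquivZPowers ht), finsum_eq_sum_of_fintype, Finset.sum_range]
  refine Finset.sum_congr rfl fun i _ => ?_
  simp only [brauerCharacter, finEquivZPowers_apply, map_pow, roots_charpoly_pow,
    Multiset.map_map, Function.comp_def]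

include hlift

open Classical in
theorem cyclicAverage_brauerCharacter_eq_count (t : PRegular p T) (ht : IsOfFinOrder t.1) :
    cyclicAverage (brauerCharacter lift ρ) t = (ρ t.1).charpoly.roots.count 1 := by
  have pow_eq_one : ∀ z ∈ (ρ t.1).charpoly.roots.map lift, z ^ orderOf t.1 = 1 := by
    simp only [Multiset.mem_map, forall_exists_index, and_imp, forall_apply_eq_imp_iff₂]
    intro ε hε
    rw [← map_pow, pow_eq_one_of_mem_roots_charpoly _ hε, map_one]
    rw [← map_pow, pow_orderOf_eq_one, map_one]
  have orderOf_ne_zero : (orderOf t.1 : ℂ) ≠ 0 := Nat.cast_ne_zero.2 ht.orderOf_pos.ne'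
  rw [cyclicAverage, finsum_zpowers_brauerCharacter ρ lift t ht,
    sum_range_sum_map_pow_eq_mul_count pow_eq_one, one_div, inv_mul_cancel_left₀ orderOf_ne_zero,
    ← map_one lift, Multiset.count_map_eq_count' _ _ hlift]

open scoped ComplexOrder in
theorem cyclicAverage_brauerCharacter_pos_iff (t : PRegular p T) (ht : IsOfFinOrder t.1) :
    0 < cyclicAverage (brauerCharacter lift ρ) t ↔ ∃ v, v ≠ 0 ∧ ρ t.1 v = v := by
  classical
  rw [cyclicAverage_brauerCharacter_eq_count hlift ρ t ht, Nat.cast_pos, Multiset.count_pos,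
    one_mem_roots_charpoly_iff]

theorem mem_positiveAveragePrimes_brauerCharacter_iff {r : ℕ} :
    r ∈ positiveAveragePrimes (brauerCharacter lift ρ) ↔
      r.Prime ∧ r ≠ p ∧ ∃ t : T, orderOf t = r ∧ ∃ v, v ≠ 0 ∧ ρ t v = v := by
  have pos_iff (t : PRegular p T) (hr : r.Prime) (ht : orderOf t.1 = r) :=
    cyclicAverage_brauerCharacter_pos_iff hlift ρ t (orderOf_pos_iff.1 (ht ▸ hr.pos))
  constructor
  · rintro ⟨hr, t, ht, hpos⟩
    refine ⟨hr, ?_, t.1, ht, (pos_iff t hr ht).1 hpos⟩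
    rintro rfl
    exact t.2 ht.symm.dvd
  · rintro ⟨hr, hrp, t, rfl, hv⟩
    have ht : ¬ p ∣ orderOf t := fun h =>
      hrp ((Nat.prime_dvd_prime_iff_eq Fact.out hr).1 h).symm
    exact ⟨hr, ⟨t, ht⟩, rfl, (pos_iff ⟨t, ht⟩ hr rfl).2 hv⟩

end BrauerCharacter

section SemidirectProduct

open SemidirectProduct

variable {N : Type v} [Group N] {T : Type u} [Group T] {φ : T →* MulAut N}

/-- The orders of the elements of `T` that fix a nontrivial element of `N` under the action `φ`. -/
def fixedPointOrders (φ : T →* MulAut N) : Set ℕ :=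
  {m | ∃ t : T, orderOf t = m ∧ ∃ n : N, n ≠ 1 ∧ φ t n = n}

theorem orderOf_right_dvd (g : N ⋊[φ] T) : orderOf g.right ∣ orderOf g :=
  orderOf_map_dvd rightHom g

theorem exists_pow_orderOf_right_eq_inl (g : N ⋊[φ] T) :
    ∃ n : N, g ^ orderOf g.right = inl n := by
  have mem_ker : g ^ orderOf g.right ∈ (rightHom : N ⋊[φ] T →* T).ker := by
    rw [MonoidHom.mem_ker, map_pow]
    exact pow_orderOf_eq_one g.right
  rw [← range_inl_eq_ker_rightHom] at mem_ker
  exact mem_ker.imp fun n hn => hn.symm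

theorem orderOf_dvd_orderOf_right_mul {p : ℕ} (hN : ∀ n : N, n ^ p = 1) (g : N ⋊[φ] T) :
    orderOf g ∣ orderOf g.right * p := by
  obtain ⟨n, hn⟩ := exists_pow_orderOf_right_eq_inl g
  exact orderOf_dvd_of_pow_eq_one (by rw [pow_mul, hn, ← map_pow, hN, map_one])

theorem exists_orderOf_eq_iff_of_coprime {p m : ℕ} (hN : ∀ n : N, n ^ p = 1)
    (hm : m.Coprime p) : (∃ g : N ⋊[φ] T, orderOf g = m) ↔ ∃ t : T, orderOf t = m := by
  constructor
  · rintro ⟨g, rfl⟩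
    exact ⟨g.right, Nat.dvd_antisymm (orderOf_right_dvd g)
      (hm.dvd_of_dvd_mul_right (orderOf_dvd_orderOf_right_mul hN g))⟩
  · rintro ⟨t, rfl⟩
    exact ⟨inr t, orderOf_injective inr inr_injective t⟩

theorem orderOf_inl_mul_inr_of_fixed {n : N} {t : T} (hfix : φ t n = n)
    (hcop : (orderOf n).Coprime (orderOf t)) :
    orderOf (inl n * inr t : N ⋊[φ] T) = orderOf n * orderOf t := by
  have commute : Commute (inl n : N ⋊[φ] T) (inr t) := by ext <;> simp [hfix]
  have orderOf_inl : orderOf (inl n : N ⋊[φ] T) = orderOf n := orderOf_injective _ inl_injective n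
  have orderOf_inr : orderOf (inr t : N ⋊[φ] T) = orderOf t := orderOf_injective _ inr_injective t
  rw [commute.orderOf_mul_eq_mul_orderOf_of_coprime (by rwa [orderOf_inl, orderOf_inr]),
    orderOf_inl, orderOf_inr]

theorem isSolvable_ker_rightHom [Group.IsSolvable N] :
    Group.IsSolvable (rightHom : N ⋊[φ] T →* T).ker := by
  rw [← range_inl_eq_ker_rightHom]
  exact Group.isSolvable_of_surjective (inl : N →* N ⋊[φ] T).rangeRestrict_surjective

end SemidirectProduct

section CommutativeKernel

open SemidirectProduct

variable {N : Type v} [CommGroup N] {T : Type u} [Group T] {φ : T →* MulAut N}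

theorem apply_right_eq_self_of_commute_inl {g : N ⋊[φ] T} {n : N} (h : Commute g (inl n)) :
    φ g.right n = n := by
  have left_eq := congrArg left h.eq
  simp only [mul_left, left_inl, right_inl, map_one, MulAut.one_apply] at left_eq
  rwa [mul_comm n, mul_right_inj] at left_eq

theorem orderOf_right_mem_fixedPointOrders {g : N ⋊[φ] T} (h : orderOf g ≠ orderOf g.right) :
    orderOf g.right ∈ fixedPointOrders φ := by
  obtain ⟨n, hn⟩ := exists_pow_orderOf_right_eq_inl g
  refine ⟨g.right, rfl, n, ?_, apply_right_eq_self_of_commute_inl ?_⟩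
  · rintro rfl
    rw [map_one] at hn
    exact h (Nat.dvd_antisymm (orderOf_dvd_of_pow_eq_one hn) (orderOf_right_dvd g))
  · exact hn ▸ Commute.self_pow g _

theorem exists_orderOf_eq_mul_iff {p m : ℕ} (hp : p.Prime) (hN : ∀ n : N, n ^ p = 1)
    (hm : m.Coprime p) :
    (∃ g : N ⋊[φ] T, orderOf g = p * m) ↔
      (∃ t : T, orderOf t = p * m) ∨ m ∈ fixedPointOrders φ := by
  have := Fact.mk hp
  constructor
  · rintro ⟨g, hg⟩
    have hm_pos : 0 < m := Nat.pos_of_ne_zero fun h => hp.ne_one (by simpa [h] using hm)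
    obtain ⟨d, hd⟩ : m ∣ orderOf g.right := by
      refine Nat.dvd_of_mul_dvd_mul_left hp.pos ?_
      rw [← hg, mul_comm p]
      exact orderOf_dvd_orderOf_right_mul hN g
    have d_dvd : d ∣ p := by
      refine Nat.dvd_of_mul_dvd_mul_left hm_pos ?_
      rw [← hd, mul_comm m, ← hg]
      exact orderOf_right_dvd g
    rcases (Nat.dvd_prime hp).1 d_dvd with rfl | rfl
    · rw [mul_one] at hd
      rw [← hd]
      refine Or.inr (orderOf_right_mem_fixedPointOrders ?_)
      rw [hg, hd]
      exact (lt_mul_of_one_lt_left hm_pos hp.one_lt).ne'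
    · exact Or.inl ⟨g.right, hd.trans (mul_comm m d)⟩
  · rintro (⟨t, ht⟩ | ⟨t, rfl, n, hn, hfix⟩)
    · exact ⟨inr t, by rw [orderOf_injective _ inr_injective t, ht]⟩
    · have orderOf_n : orderOf n = p := orderOf_eq_prime (hN n) hn
      refine ⟨inl n * inr t, ?_⟩
      rw [orderOf_inl_mul_inr_of_fixed hfix (orderOf_n ▸ hm.symm), orderOf_n]

end CommutativeKernel

section CompositionFactors

theorem isCyclic_of_isSimpleGroup_of_isSolvable (Q : Type*) [Group Q] [IsSimpleGroup Q]
    [Group.IsSolvable Q] : IsCyclic Q := by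
  let _ : CommGroup Q :=
    { ‹Group Q› with mul_comm := IsSimpleGroup.comm_iff_isSolvable.2 inferInstance }
  exact IsSimpleGroup.isCyclic

section Quotient

variable {A Q T : Type*} [Group A] [Group Q] [Group T] {q : A →* Q} {f : A →* T}

theorem isCyclic_or_ker_le_ker [IsSimpleGroup Q] (hq : Function.Surjective q)
    [Group.IsSolvable f.ker] : IsCyclic Q ∨ f.ker ≤ q.ker := by
  have map_normal : (f.ker.map q).Normal := Subgroup.Normal.map inferInstance q hq
  rcases map_normal.eq_bot_or_eq_top with h | h
  · exact Or.inr ((Subgroup.map_eq_bot_iff _).1 h)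
  · have surjective : Function.Surjective (q.comp f.ker.subtype) := by
      rw [← MonoidHom.range_eq_top, MonoidHom.range_comp, Subgroup.range_subtype, h]
    have := Group.isSolvable_of_surjective surjective
    exact Or.inl (isCyclic_of_isSimpleGroup_of_isSolvable Q)

theorem nonempty_mulEquiv_of_ker_le_ker [Nontrivial Q] (hq : Function.Surjective q)
    (hker : f.ker ≤ q.ker) (hrange : f.range = ⊥ ∨ f.range = ⊤)
    (hmap : q.ker.map f = ⊥ ∨ q.ker.map f = ⊤) : Nonempty (Q ≃* T) := by
  have ker_ne_top : q.ker ≠ ⊤ := by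
    rw [Ne, MonoidHom.ker_eq_top_iff]
    rintro rfl
    obtain ⟨x, hx⟩ := exists_ne (1 : Q)
    exact hx (hq x).choose_spec.symm
  have comap_map_ker : (q.ker.map f).comap f = q.ker := Subgroup.comap_map_eq_self hker
  have map_ker_eq_bot : q.ker.map f = ⊥ := by
    refine hmap.resolve_right fun h => ker_ne_top ?_
    rw [← comap_map_ker, h, Subgroup.comap_top]
  have ker_eq : q.ker = f.ker := by
    rw [← comap_map_ker, map_ker_eq_bot, MonoidHom.comap_bot]
  have f_surjective : Function.Surjective f := by
    refine MonoidHom.range_eq_top.1 (hrange.resolve_left fun h => ker_ne_top ?_)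
    rw [ker_eq, MonoidHom.ker_eq_top_iff, ← MonoidHom.range_eq_bot_iff, h]
  exact ⟨(QuotientGroup.quotientKerEquivOfSurjective q hq).symm.trans
    ((QuotientGroup.quotientMulEquivOfEq ker_eq).trans
      (QuotientGroup.quotientKerEquivOfSurjective f f_surjective))⟩

theorem nonempty_quotient_subgroupOf_mulEquiv {K H : Subgroup A} [(K.subgroupOf H).Normal]
    (hK : K = f.ker) (hH : H.map f = ⊤) : Nonempty (H ⧸ K.subgroupOf H ≃* T) := by
  have ker_eq : K.subgroupOf H = (f.comp H.subtype).ker := by rw [hK]; rfl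
  have surjective : Function.Surjective (f.comp H.subtype) := by
    rw [← MonoidHom.range_eq_top, MonoidHom.range_comp, Subgroup.range_subtype, hH]
  exact ⟨(QuotientGroup.quotientMulEquivOfEq ker_eq).trans
    (QuotientGroup.quotientKerEquivOfSurjective _ surjective)⟩

end Quotient

variable {G : Type u} [Group G] {T : Type v} [Group T] [IsSimpleGroup T] {f : G →* T}

theorem GroupCompositionSeries.map_eq_bot_or_eq_top (c : GroupCompositionSeries G)
    (hf : Function.Surjective f) (i : Fin (c.length + 1)) :
    (c.term i).map f = ⊥ ∨ (c.term i).map f = ⊤ := by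
  induction i using Fin.reverseInduction with
  | last =>
    right
    rw [c.term_last, ← MonoidHom.range_eq_map, MonoidHom.range_eq_top.2 hf]
  | cast i ih =>
    rcases ih with h | h
    · exact Or.inl (le_bot_iff.1 (h ▸ Subgroup.map_mono (c.le_succ i)))
    · refine Subgroup.Normal.eq_bot_or_eq_top ⟨?_⟩
      rintro _ ⟨a, ha, rfl⟩ y
      obtain ⟨b, hb, rfl⟩ : y ∈ (c.term i.succ).map f := h ▸ Subgroup.mem_top y
      refine ⟨b * a * b⁻¹, ?_, by simp⟩
      exact (c.normal i).conj_mem ⟨a, c.le_succ i ha⟩ (Subgroup.mem_subgroupOf.2 ha) ⟨b, hb⟩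

theorem isSolvableRel_of_surjective (hf : Function.Surjective f) [Group.IsSolvable f.ker] :
    IsSolvableRel T G := by
  intro c i
  have := c.normal i
  have := c.simple i
  let q : c.term i.succ →* c.factor i := QuotientGroup.mk' _
  let fi : c.term i.succ →* T := f.comp (c.term i.succ).subtype
  have hq : Function.Surjective q := QuotientGroup.mk'_surjective _
  have range_fi : fi.range = (c.term i.succ).map f := by
    rw [MonoidHom.range_comp, Subgroup.range_subtype]
  have map_ker_q : q.ker.map fi = (c.term i.castSucc).map f := by
    rw [QuotientGroup.ker_mk', ← Subgroup.map_map, Subgroup.subgroupOf_map_subtype,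
      inf_eq_left.2 (c.le_succ i)]
  have : Group.IsSolvable fi.ker :=
    Group.isSolvable_of_isSolvable_injective (f := (c.term i.succ).subtype.subgroupComap f.ker)
      fun _ _ h => Subtype.ext (Subtype.ext (congrArg ((↑) : f.ker → G) h))
  refine (isCyclic_or_ker_le_ker (f := fi) hq).imp_right fun hker => ?_
  refine nonempty_mulEquiv_of_ker_le_ker hq hker ?_ ?_
  · exact range_fi ▸ c.map_eq_bot_or_eq_top hf _
  · exact map_ker_q ▸ c.map_eq_bot_or_eq_top hf _

/-- `K` is a maximal normal subgroup of `H`, encoded as a normal subgroup with simple quotient: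
the relation between consecutive terms of a composition series. -/
structure IsMaximalNormal (K H : Subgroup G) : Prop where
  le : K ≤ H
  normal : (K.subgroupOf H).Normal
  simple : IsSimpleGroup (H ⧸ K.subgroupOf H)

theorem isMaximalNormal_map_subtype {H : Subgroup G} (K : Subgroup H) [hK : K.Normal]
    [hsimple : IsSimpleGroup (H ⧸ K)] : IsMaximalNormal (K.map H.subtype) H := by
  have subgroupOf_eq : (K.map H.subtype).subgroupOf H = K :=
    Subgroup.comap_map_eq_self_of_injective H.subtype_injective K
  have normal : ((K.map H.subtype).subgroupOf H).Normal := by rwa [subgroupOf_eq]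
  exact ⟨Subgroup.map_subtype_le K, normal,
    (QuotientGroup.quotientMulEquivOfEq subgroupOf_eq).isSimpleGroup⟩

theorem IsMaximalNormal.lt {K H : Subgroup G} (h : IsMaximalNormal K H) : K < H := by
  have := h.normal
  have := h.simple
  have subgroupOf_ne_top : K.subgroupOf H ≠ ⊤ := QuotientGroup.nontrivial_iff.1 inferInstance
  exact h.le.lt_of_not_ge fun hle => subgroupOf_ne_top (Subgroup.subgroupOf_eq_top.2 hle)

theorem isSimpleGroup_quotient_of_maximal {K : Subgroup G} [K.Normal]
    (hK : Maximal (fun N : Subgroup G => N.Normal ∧ N ≠ ⊤) K) : IsSimpleGroup (G ⧸ K) := by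
  have : Nontrivial (G ⧸ K) := (QuotientGroup.nontrivial_iff).2 hK.prop.2
  refine { eq_bot_or_eq_top_of_normal := fun J hJ => ?_ }
  have le_comap : K ≤ J.comap (QuotientGroup.mk' K) := by
    rw [← Subgroup.map_le_iff_le_comap, (Subgroup.map_eq_bot_iff K).2 (QuotientGroup.ker_mk' K).ge]
    exact bot_le
  rw [← Subgroup.map_comap_eq_self_of_surjective (QuotientGroup.mk'_surjective K) J]
  by_cases h : J.comap (QuotientGroup.mk' K) = ⊤
  · right
    rw [h, Subgroup.map_top_of_surjective _ (QuotientGroup.mk'_surjective K)]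
  · left
    rw [Subgroup.map_eq_bot_iff, QuotientGroup.ker_mk']
    exact hK.le_of_ge ⟨inferInstance, h⟩ le_comap

theorem exists_normal_isSimpleGroup_quotient (G : Type*) [Group G] [Finite G] [Nontrivial G] :
    ∃ (K : Subgroup G) (_ : K.Normal), IsSimpleGroup (G ⧸ K) := by
  obtain ⟨K, hK⟩ := {N : Subgroup G | N.Normal ∧ N ≠ ⊤}.toFinite.exists_maximal
    ⟨⊥, inferInstance, bot_ne_top⟩
  have := hK.prop.1
  exact ⟨K, this, isSimpleGroup_quotient_of_maximal hK⟩

theorem exists_relSeries_isMaximalNormal [Finite G] (H : Subgroup G) :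
    ∃ s : RelSeries {(K, H) : Subgroup G × Subgroup G | IsMaximalNormal K H},
      s.head = ⊥ ∧ s.last = H := by
  induction H using WellFoundedLT.induction with
  | ind H ih =>
    rcases eq_or_ne H ⊥ with rfl | hH
    · exact ⟨RelSeries.singleton _ ⊥, rfl, rfl⟩
    · have : Nontrivial H := H.nontrivial_iff_ne_bot.2 hH
      obtain ⟨K, _, _⟩ := exists_normal_isSimpleGroup_quotient H
      have hKH := isMaximalNormal_map_subtype K
      obtain ⟨s, hhead, hlast⟩ := ih _ hKH.lt
      exact ⟨s.snoc H (hlast ▸ hKH), (s.head_snoc _ _).trans hhead, s.last_snoc _ _⟩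

/-- The composition series given by a chain of maximal normal subgroups from `⊥` to `⊤`. -/
def GroupCompositionSeries.ofRelSeries
    (s : RelSeries {(K, H) : Subgroup G × Subgroup G | IsMaximalNormal K H})
    (hhead : s.head = ⊥) (hlast : s.last = ⊤) : GroupCompositionSeries G where
  length := s.length
  term := s
  term_zero := hhead
  term_last := hlast
  le_succ i := IsMaximalNormal.le (s.step i)
  normal i := IsMaximalNormal.normal (s.step i)
  simple i := IsMaximalNormal.simple (s.step i)

theorem isMaximalNormal_ker_top (hf : Function.Surjective f) : IsMaximalNormal f.ker ⊤ := by
  have normal : (f.ker.subgroupOf ⊤).Normal := inferInstance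
  obtain ⟨e⟩ := nonempty_quotient_subgroupOf_mulEquiv (K := f.ker) rfl
    (Subgroup.map_top_of_surjective f hf)
  exact ⟨le_top, normal, e.isSimpleGroup⟩

theorem isCompositionFactor_of_surjective [Finite G] (hf : Function.Surjective f) :
    IsCompositionFactor T G := by
  obtain ⟨s, hhead, hlast⟩ := exists_relSeries_isMaximalNormal f.ker
  have step : IsMaximalNormal s.last ⊤ := hlast ▸ isMaximalNormal_ker_top hf
  let c := GroupCompositionSeries.ofRelSeries (s.snoc ⊤ step)
    ((s.head_snoc ⊤ step).trans hhead) (s.last_snoc ⊤ step)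
  let i : Fin c.length := Fin.last s.length
  have term_castSucc : c.term i.castSucc = f.ker := (s.snoc_castSucc ⊤ step _).trans hlast
  have map_term_succ : (c.term i.succ).map f = ⊤ := by
    rw [show c.term i.succ = ⊤ from c.term_last, Subgroup.map_top_of_surjective f hf]
  have := c.normal i
  exact ⟨c, i, nonempty_quotient_subgroupOf_mulEquiv term_castSucc map_term_succ⟩

theorem isStrictlySolvableRel_of_surjective [Finite G] (hf : Function.Surjective f)
    [Group.IsSolvable f.ker] : IsStrictlySolvableRel T G :=
  ⟨isSolvableRel_of_surjective hf, isCompositionFactor_of_surjective hf⟩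

end CompositionFactors

section InvariantSubgroup

variable {T : Type u} [Group T]

/-- The action of `T` on an invariant subgroup `M` of `N`. -/
def restrictAction {N : Type v} [Group N] (φ : T →* MulAut N) (M : Subgroup N)
    (hM : ∀ t, ∀ n ∈ M, φ t n ∈ M) : T →* MulAut M where
  toFun t :=
    { toFun := fun n => ⟨φ t n, hM t n n.2⟩
      invFun := fun n => ⟨φ t⁻¹ n, hM t⁻¹ n n.2⟩
      left_inv := fun n => by simp
      right_inv := fun n => by simp
      map_mul' := fun a b => by simp }
  map_one' := by ext; simp
  map_mul' a b := by ext; simp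

theorem fixedPointOrders_restrictAction_subset {N : Type v} [Group N] {φ : T →* MulAut N}
    {M : Subgroup N} (hM : ∀ t, ∀ n ∈ M, φ t n ∈ M) :
    fixedPointOrders (restrictAction φ M hM) ⊆ fixedPointOrders φ := by
  rintro m ⟨t, ht, n, hn, hfix⟩
  exact ⟨t, ht, n, OneMemClass.coe_eq_one.not.2 hn, congrArg Subtype.val hfix⟩

variable {N : Type v} [CommGroup N]

theorem finite_closure_of_isMulTorsion (hN : IsMulTorsion N) {S : Set N} (hS : S.Finite) :
    Finite (Subgroup.closure S) := by
  have := hS.to_subtype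
  have := Group.closure_finite_fg S
  refine CommGroup.finite_of_fg_isMulTorsion _ fun n => ?_
  exact Submonoid.isOfFinOrder_coe.1 (hN n)

theorem exists_finite_invariant_subgroup [Finite T] (hN : IsMulTorsion N) (φ : T →* MulAut N)
    {S : Set N} (hS : S.Finite) :
    ∃ M : Subgroup N, Finite M ∧ S ⊆ M ∧ ∀ t, ∀ n ∈ M, φ t n ∈ M := by
  let orbits : Set N := ⋃ t, φ t '' S
  refine ⟨Subgroup.closure orbits,
    finite_closure_of_isMulTorsion hN (Set.finite_iUnion fun t => hS.image _), ?_, fun t => ?_⟩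
  · refine Set.Subset.trans (fun n hn => ?_) Subgroup.subset_closure
    exact Set.mem_iUnion.2 ⟨1, n, hn, by simp⟩
  · suffices Subgroup.closure orbits ≤ (Subgroup.closure orbits).comap (φ t).toMonoidHom from this
    rw [Subgroup.closure_le]
    rintro n hn
    obtain ⟨s, x, hx, rfl⟩ := Set.mem_iUnion.1 hn
    exact Subgroup.subset_closure (Set.mem_iUnion.2 ⟨t * s, x, hx, by simp⟩)

theorem exists_finite_subgroup_fixedPointOrders_eq [Finite T] (hN : IsMulTorsion N)
    (φ : T →* MulAut N) :
    ∃ (M : Subgroup N) (hM : ∀ t, ∀ n ∈ M, φ t n ∈ M), Finite M ∧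
      fixedPointOrders (restrictAction φ M hM) = fixedPointOrders φ := by
  choose! n hn using fun (t : T) (h : ∃ n, n ≠ 1 ∧ φ t n = n) => h
  obtain ⟨M, hfin, hnM, hM⟩ := exists_finite_invariant_subgroup hN φ (Set.finite_range n)
  refine ⟨M, hM, hfin, (fixedPointOrders_restrictAction_subset hM).antisymm ?_⟩
  rintro m ⟨t, ht, hfix⟩
  refine ⟨t, ht, ⟨n t, hnM ⟨t, rfl⟩⟩, ?_, Subtype.ext (hn t hfix).2⟩
  exact fun h => (hn t hfix).1 (congrArg Subtype.val h)

end InvariantSubgroup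

section MultiplicativeAction

variable {k : Type*} [CommSemiring k] {T : Type u} [Group T] {V : Type w} [AddCommGroup V]
  [Module k V]

/-- The action of `T` on the additive group of the representation `ρ`, written multiplicatively. -/
def multiplicativeAction (ρ : Representation k T V) : T →* MulAut (Multiplicative V) where
  toFun t := AddEquiv.toMultiplicative
    (LinearMap.GeneralLinearGroup.generalLinearEquiv k V (ρ.asGroupHom t)).toAddEquiv
  map_one' := by ext; simp
  map_mul' s t := by ext; simp

theorem mem_fixedPointOrders_multiplicativeAction_iff (ρ : Representation k T V) {m : ℕ} :
    m ∈ fixedPointOrders (multiplicativeAction ρ) ↔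
      ∃ t : T, orderOf t = m ∧ ∃ v, v ≠ 0 ∧ ρ t v = v :=
  Iff.rfl

end MultiplicativeAction

section PrimeGraph

variable {N : Type v} {T : Type u} [Group T] {p : ℕ}

theorem primeDivisors_semidirectProduct [Group N] [Finite N] {φ : T →* MulAut N}
    (hp : p ∈ primeDivisors T) (hN : ∀ n : N, n ^ p = 1) :
    primeDivisors (N ⋊[φ] T) = primeDivisors T := by
  ext r
  simp only [primeDivisors, Set.mem_ofPred_eq, SemidirectProduct.card]
  refine and_congr_right fun hr => ⟨fun h => ?_, fun h => h.mul_left _⟩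
  refine (hr.dvd_mul.1 h).elim (fun hrN => ?_) id
  have := Fact.mk hr
  obtain ⟨n, hn⟩ := exists_prime_orderOf_dvd_card' r hrN
  have r_dvd_p : r ∣ p := hn ▸ orderOf_dvd_of_pow_eq_one (hN n)
  exact (Nat.prime_dvd_prime_iff_eq hr hp.1).1 r_dvd_p ▸ hp.2

theorem exists_orderOf_eq_prime_mul_prime_iff [CommGroup N] {φ : T →* MulAut N} (hp : p.Prime)
    (hN : ∀ n : N, n ^ p = 1) {r s : ℕ} (hr : r.Prime) (hs : s.Prime) (hrs : r ≠ s) :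
    (∃ g : N ⋊[φ] T, orderOf g = r * s) ↔
      (∃ t : T, orderOf t = r * s) ∨ ∃ x ∈ fixedPointOrders φ, s(r, s) = s(p, x) := by
  rcases eq_or_ne r p with rfl | hrp
  · rw [exists_orderOf_eq_mul_iff hp hN ((Nat.coprime_primes hs hp).2 hrs.symm)]
    simp only [Sym2.congr_right, exists_eq_right']
  rcases eq_or_ne s p with rfl | hsp
  · rw [mul_comm r, Sym2.eq_swap,
      exists_orderOf_eq_mul_iff hp hN ((Nat.coprime_primes hr hp).2 hrs)]
    simp only [Sym2.congr_right, exists_eq_right']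
  · have coprime : (r * s).Coprime p :=
      ((Nat.coprime_primes hr hp).2 hrp).mul_left ((Nat.coprime_primes hs hp).2 hsp)
    have ne_edge (x : ℕ) : s(r, s) ≠ s(p, x) := by simp [hrp, hsp]
    simp only [exists_orderOf_eq_iff_of_coprime hN coprime, ne_edge, and_false, exists_false,
      or_false]

theorem primeGraphCompl_adj {G : Type*} [Group G] {r s : ℕ} :
    (primeGraphCompl G).Adj r s ↔
      r ∈ primeDivisors G ∧ s ∈ primeDivisors G ∧ r ≠ s ∧ ¬ ∃ g : G, orderOf g = r * s := by
  simp only [primeGraphCompl, LabelledGraph.complement, primeGraph]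
  tauto

theorem primeGraphCompl_semidirectProduct [CommGroup N] [Finite N] {φ : T →* MulAut N}
    (hp : p ∈ primeDivisors T) (hN : ∀ n : N, n ^ p = 1) :
    primeGraphCompl (N ⋊[φ] T) =
      (primeGraphCompl T).deleteEdges {e | ∃ r ∈ fixedPointOrders φ, e = s(p, r)} := by
  have verts_eq : primeDivisors (N ⋊[φ] T) = primeDivisors T :=
    primeDivisors_semidirectProduct hp hN
  refine SimpleGraph.Subgraph.ext verts_eq ?_
  ext r s
  simp only [SimpleGraph.Subgraph.deleteEdges_adj, primeGraphCompl_adj, verts_eq, and_assoc]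
  refine and_congr_right fun hr => and_congr_right fun hs => and_congr_right fun hrs => ?_
  rw [exists_orderOf_eq_prime_mul_prime_iff hp.1 hN hr.1 hs.1 hrs, not_or]
  rfl

theorem primeGraphCompl_deleteEdges_congr {R R' : Set ℕ}
    (h : ∀ r, r.Prime → r ≠ p → (r ∈ R ↔ r ∈ R')) :
    (primeGraphCompl T).deleteEdges {e | ∃ r ∈ R, e = s(p, r)} =
      (primeGraphCompl T).deleteEdges {e | ∃ r ∈ R', e = s(p, r)} := by
  refine SimpleGraph.Subgraph.ext rfl ?_
  ext a b
  simp only [SimpleGraph.Subgraph.deleteEdges_adj, Set.mem_ofPred_eq]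
  refine and_congr_right fun hab => not_congr (exists_congr fun r => and_congr_left fun he => ?_)
  have ⟨ha, hb, hne, _⟩ := primeGraphCompl_adj.1 hab
  rcases Sym2.eq_iff.1 he with ⟨rfl, rfl⟩ | ⟨rfl, rfl⟩
  · exact h b hb.1 hne.symm
  · exact h a ha.1 hne

theorem exists_isStrictlySolvableRel_primeGraphCompl_eq [Finite T] [IsSimpleGroup T] [CommGroup N]
    (hp : p ∈ primeDivisors T) (hN : ∀ n : N, n ^ p = 1) (φ : T →* MulAut N) :
    ∃ (G : Type (max v u)) (_ : Group G), Finite G ∧ IsStrictlySolvableRel T G ∧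
      primeGraphCompl G =
        (primeGraphCompl T).deleteEdges {e | ∃ r ∈ fixedPointOrders φ, e = s(p, r)} := by
  have hN_torsion : IsMulTorsion N := fun n =>
    isOfFinOrder_iff_pow_eq_one.2 ⟨p, hp.1.pos, hN n⟩
  obtain ⟨M, hM, _, fixedPointOrders_eq⟩ := exists_finite_subgroup_fixedPointOrders_eq hN_torsion φ
  have finite : Finite (M ⋊[restrictAction φ M hM] T) :=
    .of_equiv _ SemidirectProduct.equivProd.symm
  have := isSolvable_ker_rightHom (φ := restrictAction φ M hM)
  refine ⟨M ⋊[restrictAction φ M hM] T, inferInstance, finite,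
    isStrictlySolvableRel_of_surjective SemidirectProduct.rightHom_surjective, ?_⟩
  rw [← fixedPointOrders_eq]
  exact primeGraphCompl_semidirectProduct hp fun n => Subtype.ext (hN n)

end PrimeGraph

theorem mainTheorem7_general {T : Type u} [Group T] [Finite T] [IsSimpleGroup T]
    (p : ℕ) [Fact p.Prime] (hp : p ∈ primeDivisors T)
    (lift : AlgebraicClosure (ZMod p) →*₀ ℂ) (hlift : Function.Injective lift)
    {V : Type w} [AddCommGroup V] [Module (AlgebraicClosure (ZMod p)) V]
    [FiniteDimensional (AlgebraicClosure (ZMod p)) V]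
    (ρ : Representation (AlgebraicClosure (ZMod p)) T V) :
    ∃ (G : Type (max w u)) (_ : Group G), Finite G ∧ IsStrictlySolvableRel T G ∧
      primeGraphCompl G = (primeGraphCompl T).deleteEdges
        {e | ∃ r ∈ positiveAveragePrimes (brauerCharacter lift ρ), e = s(p, r)} := by
  have pow_p_eq_one (v : Multiplicative V) : v ^ p = 1 := by
    refine Multiplicative.toAdd.injective ?_
    rw [toAdd_pow, toAdd_one, ← Nat.cast_smul_eq_nsmul (AlgebraicClosure (ZMod p)),
      CharP.cast_eq_zero, zero_smul]
  have mem_iff (r : ℕ) (hr : r.Prime) (hrp : r ≠ p) :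
      r ∈ positiveAveragePrimes (brauerCharacter lift ρ) ↔
        r ∈ fixedPointOrders (multiplicativeAction ρ) := by
    rw [mem_positiveAveragePrimes_brauerCharacter_iff hlift ρ,
      mem_fixedPointOrders_multiplicativeAction_iff]
    simp only [hr, hrp, ne_eq, not_false_eq_true, true_and]
  rw [primeGraphCompl_deleteEdges_congr mem_iff]
  exact exists_isStrictlySolvableRel_primeGraphCompl_eq hp pow_p_eq_one (multiplicativeAction ρ)

theorem mainTheorem7 {T : Type u} [Group T] [Finite T] [IsSimpleGroup T]
    (p : ℕ) [Fact p.Prime] (hp : p ∈ primeDivisors T)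
    (lift : AlgebraicClosure (ZMod p) →*₀ ℂ) (hlift : Function.Injective lift)
    (χ : PRegular p T → ℂ) (hχ : IsIrreducibleBrauerCharacter lift χ) :
    ∃ (G : Type u) (_ : Group G), Finite G ∧ IsStrictlySolvableRel T G ∧
      primeGraphCompl G =
        (primeGraphCompl T).deleteEdges {e | ∃ r ∈ positiveAveragePrimes χ, e = s(p, r)} := by
  obtain ⟨n, ρ, -, rfl⟩ := hχ
  exact mainTheorem7_general p hp lift hlift ρ
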